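/- Let $n\ge 2$. Let $VSB_n$ be the virtual singular braid monoid: the monoid generated by $\sigma_i,\sigma_i^{-1},\tau_i,v_i$ ($1\le i\le n-1$) with defining relations 1. $\sigma_i\sigma_i^{-1}=\sigma_i^{-1}\sigma_i=1_n$ and $v_i^2=1_n$; 2. for $|i-j|=1$: $\sigma_i\sigma_j\sigma_i=\sigma_j\sigma_i\sigma_j$, $v_iv_jv_i=v_jv_iv_j$, $v_i\sigma_jv_i=v_j\sigma_iv_j$, $v_i\tau_jv_i=v_j\tau_iv_j$, $\sigma_i\sigma_j\tau_i=\tau_j\sigma_i\sigma_j$; 3. $\sigma_i\tau_i=\tau_i\sigma_i$; 4. $g_ih_j=h_jg_i$ for $|i-j|>1$ and $g,h\in\{\sigma,\tau,v\}$. Let $\pi\colon VSB_n\to S_n$ be the homomorphism sending each of $\sigma_i,\sigma_i^{-1},\tau_i,v_i$ to the transposition $(i,i+1)$, and let the virtual singular pure braid monoid be $VSP_n=\ker\pi=\{x\in VSB_n\mid \pi(x)=1\}$. Put $\mu_i=\sigma_iv_i$, $\mu_i^{-1}=v_i\sigma_i^{-1}$, $\gamma_i=\tau_iv_i$. For $x\in\{\mu,\mu^{-1},\gamma\}$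 and $1\le i<j\le n$ define the generalized fusing strings $$x_{ij}=(v_{j-1}v_{j-2}\cdots v_{i+1})\,x_i\,(v_{i+1}\cdots v_{j-2}v_{j-1}),\qquad x_{ji}=(v_{j-1}v_{j-2}\cdots v_{i+1})\,v_i\,x_i\,v_i\,(v_{i+1}\cdots v_{j-2}v_{j-1}),$$ where $\mu^{-1}_{kl}$ is written $\mu_{kl}^{-1}$. **Theorem.** The monoid $VSP_n$ is generated by the generalized fusing strings $\mu_{kl},\mu_{kl}^{-1},\gamma_{kl}$ ($1\le k\ne l\le n$), and the following are defining relations for these generators, that is, the monoid presented by these generators and relations is isomorphic to $VSP_n$ by an isomorphism taking each generator to the corresponding generalized fusing string (distinct letters stand for distinct indices): $$\mu_{kl}\mu_{kl}^{-1}=\mu_{kl}^{-1}\mu_{kl}=1_n,$$ $$\mu_{ij}\mu_{ik}\mu_{jk}=\mu_{jk}\mu_{ik}\mu_{ij},\qquad \mu_{ij}\mu_{ik}\gamma_{jk}=\gamma_{jk}\mu_{ik}\mu_{ij},\qquad \gamma_{ij}\mu_{ik}\mu_{jk}=\mu_{jk}\mu_{ik}\gamma_{ij},$$ $$\mu_{kl}\gamma_{lk}=\gamma_{kl}\mu_{lk},$$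 $$\mu_{ij}\mu_{kl}=\mu_{kl}\mu_{ij},\qquad \gamma_{ij}\gamma_{kl}=\gamma_{kl}\gamma_{ij},\qquad \mu_{ij}\gamma_{kl}=\gamma_{kl}\mu_{ij}.$$ -/

import Mathlib

/-! Strands are labelled by `Fin n`, i.e. `0, …, n - 1`, and the elementary braids by `Fin (n - 1)`:
the elementary braids with label `i` cross the strands `i` and `i + 1`. All labels are thus shifted
by one from the usual labels `1, …, n` and `1, …, n - 1`. -/

namespace VSBraid

/-- The elementary virtual singular braids `σ_i`, `σ_i⁻¹`, `τ_i`, `v_i`, as formal letters. -/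
inductive BraidGen (n : ℕ) : Type
  | sigma (i : Fin (n - 1))
  | sigmaInv (i : Fin (n - 1))
  | tau (i : Fin (n - 1))
  | v (i : Fin (n - 1))

/-- `|i - j| = 1` -/
def Adjacent {m : ℕ} (i j : Fin m) : Prop := i.val + 1 = j.val ∨ j.val + 1 = i.val

/-- `|i - j| > 1` -/
def Far {m : ℕ} (i j : Fin m) : Prop := i.val + 1 < j.val ∨ j.val + 1 < i.val

section
open BraidGen
open FreeMonoid (of)

/-- The defining relations of the virtual singular braid monoid. -/
inductive BraidRel (n : ℕ) : FreeMonoid (BraidGen n) → FreeMonoid (BraidGen n) → Prop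
  | sigma_inv (i : Fin (n - 1)) : BraidRel n (of (sigma i) * of (sigmaInv i)) 1
  | inv_sigma (i : Fin (n - 1)) : BraidRel n (of (sigmaInv i) * of (sigma i)) 1
  | v_sq (i : Fin (n - 1)) : BraidRel n (of (v i) * of (v i)) 1
  | r3 (i j : Fin (n - 1)) (h : Adjacent i j) : BraidRel n
      (of (sigma i) * of (sigma j) * of (sigma i)) (of (sigma j) * of (sigma i) * of (sigma j))
  | v3 (i j : Fin (n - 1)) (h : Adjacent i j) : BraidRel n
      (of (v i) * of (v j) * of (v i)) (of (v j) * of (v i) * of (v j))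
  | vr3 (i j : Fin (n - 1)) (h : Adjacent i j) : BraidRel n
      (of (v i) * of (sigma j) * of (v i)) (of (v j) * of (sigma i) * of (v j))
  | vs3 (i j : Fin (n - 1)) (h : Adjacent i j) : BraidRel n
      (of (v i) * of (tau j) * of (v i)) (of (v j) * of (tau i) * of (v j))
  | rs3 (i j : Fin (n - 1)) (h : Adjacent i j) : BraidRel n
      (of (sigma i) * of (sigma j) * of (tau i)) (of (tau j) * of (sigma i) * of (sigma j))
  | rs1 (i : Fin (n - 1)) : BraidRel n
      (of (sigma i) * of (tau i)) (of (tau i) * of (sigma i))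
  | comm (g h : Fin (n - 1) → BraidGen n)
      (hg : g = sigma ∨ g = tau ∨ g = v) (hh : h = sigma ∨ h = tau ∨ h = v)
      (i j : Fin (n - 1)) (hij : Far i j) : BraidRel n
      (of (g i) * of (h j)) (of (h j) * of (g i))

end

/-- The `n`-stranded virtual singular braid monoid. -/
abbrev VSB (n : ℕ) : Type := PresentedMonoid (BraidRel n)

/-- The transposition of the strands `i` and `i + 1`. -/
def transposition {n : ℕ} (i : Fin (n - 1)) : Equiv.Perm (Fin n) :=
  Equiv.swap ⟨i.val, by omega⟩ ⟨i.val + 1, by omega⟩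

/-- The permutation of an elementary braid. -/
def genPerm {n : ℕ} : BraidGen n → Equiv.Perm (Fin n)
  | .sigma i => transposition i
  | .sigmaInv i => transposition i
  | .tau i => transposition i
  | .v i => transposition i

theorem transposition_sq {n : ℕ} (i : Fin (n - 1)) :
    transposition i * transposition i = 1 :=
  Equiv.swap_mul_self _ _

theorem swap_braid {α : Type*} [DecidableEq α] {a b c : α} (h1 : a ≠ b) (h2 : a ≠ c) (h3 : b ≠ c) :
    Equiv.swap a b * Equiv.swap b c * Equiv.swap a b
      = Equiv.swap b c * Equiv.swap a b * Equiv.swap b c := by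
  rw [Equiv.swap_mul_swap_mul_swap h1 h2, Equiv.swap_comm a b, Equiv.swap_comm b c,
    Equiv.swap_mul_swap_mul_swap h3.symm h2.symm, Equiv.swap_comm a c]

theorem transposition_braid_aux {n : ℕ} {i j : Fin (n - 1)} (h : i.val + 1 = j.val) :
    transposition i * transposition j * transposition i
      = transposition j * transposition i * transposition j := by
  have hj : transposition j = Equiv.swap (⟨i.val + 1, by omega⟩ : Fin n) ⟨j.val + 1, by omega⟩ := by
    simp only [transposition, h]
  rw [hj, transposition]
  apply swap_braid <;> simp <;> omega

theorem transposition_braid {n : ℕ} {i j : Fin (n - 1)} (h : Adjacent i j) :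
    transposition i * transposition j * transposition i
      = transposition j * transposition i * transposition j := by
  rcases h with h | h
  · exact transposition_braid_aux h
  · exact (transposition_braid_aux h).symm

theorem transposition_comm {n : ℕ} {i j : Fin (n - 1)} (h : Far i j) :
    transposition i * transposition j = transposition j * transposition i := by
  have h' : i.val + 1 < j.val ∨ j.val + 1 < i.val := h
  ext x
  by_cases hi : x.val = i.val ∨ x.val = i.val + 1 <;>
    by_cases hj : x.val = j.val ∨ x.val = j.val + 1 <;>
    simp only [transposition, Equiv.Perm.mul_apply, Equiv.swap_apply_def, Fin.ext_iff] <;> grind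

theorem genPerm_rel {n : ℕ} (a b : FreeMonoid (BraidGen n)) (h : BraidRel n a b) :
    FreeMonoid.lift genPerm a = FreeMonoid.lift genPerm b := by
  cases h with
  | sigma_inv i => simpa [genPerm] using transposition_sq i
  | inv_sigma i => simpa [genPerm] using transposition_sq i
  | v_sq i => simpa [genPerm] using transposition_sq i
  | r3 i j h => simpa [genPerm] using transposition_braid h
  | v3 i j h => simpa [genPerm] using transposition_braid h
  | vr3 i j h => simpa [genPerm] using transposition_braid h
  | vs3 i j h => simpa [genPerm] using transposition_braid h
  | rs3 i j h => simpa [genPerm] using transposition_braid h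
  | rs1 i => simp [genPerm]
  | comm g h hg hh i j hij =>
    rcases hg with rfl | rfl | rfl <;> rcases hh with rfl | rfl | rfl <;>
      simpa [genPerm] using transposition_comm hij

/-- The homomorphism `π : VSB_n → S_n` sending `σ_i`, `σ_i⁻¹`, `τ_i`, `v_i` to the transposition
of `i` and `i + 1`. -/
def perm (n : ℕ) : VSB n →* Equiv.Perm (Fin n) :=
  PresentedMonoid.lift genPerm genPerm_rel

/-- The virtual singular pure braid monoid, the kernel `{x | π x = 1}` of `π`. -/
def VSP (n : ℕ) : Submonoid (VSB n) := MonoidHom.mker (perm n)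

/-- The class in `VSB_n` of an elementary braid. -/
def braid {n : ℕ} (g : BraidGen n) : VSB n := PresentedMonoid.of (BraidRel n) g

/-- The elementary fusing string `μ_i = σ_i v_i`. -/
def elemMu {n : ℕ} (i : Fin (n - 1)) : VSB n := braid (.sigma i) * braid (.v i)

/-- The elementary fusing string `μ_i⁻¹ = v_i σ_i⁻¹`. -/
def elemMuInv {n : ℕ} (i : Fin (n - 1)) : VSB n := braid (.v i) * braid (.sigmaInv i)

/-- The elementary fusing string `γ_i = τ_i v_i`. -/
def elemGamma {n : ℕ} (i : Fin (n - 1)) : VSB n := braid (.tau i) * braid (.v i)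

/-- `v_m`, with the value `1` if `m` is not one of the labels `0, …, n - 2`
(this case does not occur below). -/
def vAt (n m : ℕ) : VSB n := if h : m < n - 1 then braid (.v ⟨m, h⟩) else 1

/-- The ascending product `v_{i+1} v_{i+2} ⋯ v_{j-1}`, for `i < j`. -/
def ascend (n i j : ℕ) : VSB n := ((List.range' (i + 1) (j - (i + 1))).map (vAt n)).prod

/-- The descending product `v_{j-1} v_{j-2} ⋯ v_{i+1}`, for `i < j`. -/
def descend (n i j : ℕ) : VSB n := ((List.range' (i + 1) (j - (i + 1))).reverse.map (vAt n)).prod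

/-- For elementary strings `x_i` and `k ≠ l`, the generalized string `x_{kl}`: for `i < j`,
`x_{ij} = (v_{j-1} ⋯ v_{i+1}) x_i (v_{i+1} ⋯ v_{j-1})` and
`x_{ji} = (v_{j-1} ⋯ v_{i+1}) v_i x_i v_i (v_{i+1} ⋯ v_{j-1})`. -/
def generalized {n : ℕ} (x : Fin (n - 1) → VSB n) (k l : Fin n) (hkl : k ≠ l) : VSB n :=
  if h : k < l then
    descend n k l * x ⟨k.val, by omega⟩ * ascend n k l
  else
    descend n l k * (braid (.v ⟨l.val, by omega⟩) * x ⟨l.val, by omega⟩ *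
      braid (.v ⟨l.val, by omega⟩)) * ascend n l k

/-- The letters `μ_{kl}`, `μ_{kl}⁻¹`, `γ_{kl}`, for `k ≠ l`. -/
inductive PureGen (n : ℕ) : Type
  | mu (k l : Fin n) (h : k ≠ l)
  | muInv (k l : Fin n) (h : k ≠ l)
  | gamma (k l : Fin n) (h : k ≠ l)

/-- The generalized fusing strings, as elements of `VSB_n`. -/
def fusing {n : ℕ} : PureGen n → VSB n
  | .mu k l h => generalized elemMu k l h
  | .muInv k l h => generalized elemMuInv k l h
  | .gamma k l h => generalized elemGamma k l h

section
open FreeMonoid (of)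
open PureGen

/-- The relations between the generalized fusing strings; distinct letters stand for distinct
indices. -/
inductive PureRel (n : ℕ) : FreeMonoid (PureGen n) → FreeMonoid (PureGen n) → Prop
  | mu_inv (k l : Fin n) (h : k ≠ l) : PureRel n (of (mu k l h) * of (muInv k l h)) 1
  | inv_mu (k l : Fin n) (h : k ≠ l) : PureRel n (of (muInv k l h) * of (mu k l h)) 1
  | yb (i j k : Fin n) (hij : i ≠ j) (hik : i ≠ k) (hjk : j ≠ k) : PureRel n
      (of (mu i j hij) * of (mu i k hik) * of (mu j k hjk))
      (of (mu j k hjk) * of (mu i k hik) * of (mu i j hij))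
  | yb_mixed (i j k : Fin n) (hij : i ≠ j) (hik : i ≠ k) (hjk : j ≠ k) : PureRel n
      (of (mu i j hij) * of (mu i k hik) * of (gamma j k hjk))
      (of (gamma j k hjk) * of (mu i k hik) * of (mu i j hij))
  | yb_mixed' (i j k : Fin n) (hij : i ≠ j) (hik : i ≠ k) (hjk : j ≠ k) : PureRel n
      (of (gamma i j hij) * of (mu i k hik) * of (mu j k hjk))
      (of (mu j k hjk) * of (mu i k hik) * of (gamma i j hij))
  | twist (k l : Fin n) (h : k ≠ l) : PureRel n
      (of (mu k l h) * of (gamma l k h.symm)) (of (gamma k l h) * of (mu l k h.symm))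
  | comm_mu_mu (i j k l : Fin n) (hij : i ≠ j) (hkl : k ≠ l)
      (hik : i ≠ k) (hil : i ≠ l) (hjk : j ≠ k) (hjl : j ≠ l) : PureRel n
      (of (mu i j hij) * of (mu k l hkl)) (of (mu k l hkl) * of (mu i j hij))
  | comm_gamma_gamma (i j k l : Fin n) (hij : i ≠ j) (hkl : k ≠ l)
      (hik : i ≠ k) (hil : i ≠ l) (hjk : j ≠ k) (hjl : j ≠ l) : PureRel n
      (of (gamma i j hij) * of (gamma k l hkl)) (of (gamma k l hkl) * of (gamma i j hij))
  | comm_mu_gamma (i j k l : Fin n) (hij : i ≠ j) (hkl : k ≠ l)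
      (hik : i ≠ k) (hil : i ≠ l) (hjk : j ≠ k) (hjl : j ≠ l) : PureRel n
      (of (mu i j hij) * of (gamma k l hkl)) (of (gamma k l hkl) * of (mu i j hij))

end

end VSBraid

/-! The group `S_n` embeds in `VSB_n` as the submonoid of virtual braids, and `VSB_n` is the
semidirect product of the presented monoid of the letters `μ_{kl}`, `μ_{kl}⁻¹`, `γ_{kl}` with `S_n`,
which acts on the letters by permuting their indices.

That the submonoid generated by the `v_i` maps isomorphically to `S_n` is the Coxeter presentation
of the symmetric group. It comes from a normal form (`exists_eq_mul_chain`): an element of the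
submonoid generated by `v_m, v_{m+1}, …` is a product of an element of the one generated by
`v_{m+1}, v_{m+2}, …` and some `v_m v_{m+1} ⋯ v_{m+r-1}`, and if its permutation fixes `m`, then
`r = 0`. The normal form also shows that a virtual braid whose permutation fixes `0` and `1` lies in
the submonoid generated by `v_2, v_3, …`, hence commutes with the elementary string `x_0`. So all
generalized strings `x_{kl}` are conjugates `s x_0 s⁻¹` of `x_0`, where `s` is any permutation with
`s 0 = k` and `s 1 = l` (`IsStringFamily.generalized_eq`), and `S_n` permutes their indices by
conjugation (`conj_fusing`).

Since `S_n` acts transitively on tuples of distinct indices, each relation between the fusing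
strings has to be checked only for the indices `0, 1, 2, 3`, where it is a relation between
elementary braids (`fusing_rel`). As `σ_i = μ_i v_i`, `τ_i = γ_i v_i` and `σ_i⁻¹ = v_i μ_i⁻¹`, every
element of `VSB_n` is a product of fusing strings followed by a virtual braid
(`exists_eq_mul_virtual`), and the latter is trivial if the permutation is, so the fusing strings
generate the kernel. Conversely the same factorizations define a homomorphism `split` from `VSB_n`
to the semidirect product, which sends every fusing string to its letter. Hence the homomorphism
from the presented monoid to `VSB_n` is injective. -/

namespace VSBraid

variable {n : ℕ}

/-! ### Relations between the elementary braids -/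

theorem vAt_of_lt {j : ℕ} (h : j < n - 1) : vAt n j = braid (.v ⟨j, h⟩) := dif_pos h

theorem vAt_of_not_lt {j : ℕ} (h : ¬ j < n - 1) : vAt n j = 1 := dif_neg h

theorem braid_v (i : Fin (n - 1)) : braid (.v i) = vAt n i := (vAt_of_lt i.isLt).symm

theorem vAt_mul_self (j : ℕ) : vAt n j * vAt n j = 1 := by
  by_cases h : j < n - 1
  · rw [vAt_of_lt h]
    exact PresentedMonoid.mk_eq_mk_of_rel (.v_sq _)
  · simp [vAt_of_not_lt h]

@[simp]
theorem vAt_mul_cancel (j : ℕ) (x : VSB n) : vAt n j * (vAt n j * x) = x := by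
  rw [← mul_assoc, vAt_mul_self, one_mul]

theorem vAt_far {i j : ℕ} (h : i + 1 < j ∨ j + 1 < i) :
    vAt n i * vAt n j = vAt n j * vAt n i := by
  by_cases hi : i < n - 1
  · by_cases hj : j < n - 1
    · rw [vAt_of_lt hi, vAt_of_lt hj]
      exact PresentedMonoid.mk_eq_mk_of_rel
        (.comm .v .v (.inr (.inr rfl)) (.inr (.inr rfl)) ⟨i, hi⟩ ⟨j, hj⟩ h)
    · simp [vAt_of_not_lt hj]
  · simp [vAt_of_not_lt hi]

theorem vAt_braid {i : ℕ} (h : i + 1 < n - 1) :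
    vAt n i * vAt n (i + 1) * vAt n i = vAt n (i + 1) * vAt n i * vAt n (i + 1) := by
  rw [vAt_of_lt h, vAt_of_lt (by omega : i < n - 1)]
  exact PresentedMonoid.mk_eq_mk_of_rel (.v3 ⟨i, by omega⟩ ⟨i + 1, h⟩ (.inl rfl))

theorem perm_braid (g : BraidGen n) : perm n (braid g) = genPerm g := rfl

theorem perm_vAt_of_lt {j : ℕ} (h : j + 1 < n) :
    perm n (vAt n j) = Equiv.swap ⟨j, by omega⟩ ⟨j + 1, h⟩ := by
  rw [vAt_of_lt (by omega), perm_braid]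
  rfl

theorem perm_vAt_of_lt_apply {m j : ℕ} (h : m < j) (hm : m < n) :
    perm n (vAt n j) ⟨m, hm⟩ = ⟨m, hm⟩ := by
  by_cases hj : j + 1 < n
  · rw [perm_vAt_of_lt hj]
    apply Equiv.swap_apply_of_ne_of_ne <;> simp <;> omega
  · rw [vAt_of_not_lt (by omega)]
    simp

/-! ### The virtual braids form a symmetric group -/

/-- The submonoid of `VSB n` generated by the virtual braids `v_j` with `m ≤ j`. -/
def virtual (n m : ℕ) : Submonoid (VSB n) := Submonoid.closure (vAt n '' Set.Ici m)

theorem vAt_mem_virtual {m j : ℕ} (h : m ≤ j) : vAt n j ∈ virtual n m :=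
  Submonoid.subset_closure ⟨j, h, rfl⟩

theorem exists_inverse_of_mem_virtual {m : ℕ} {w : VSB n} (hw : w ∈ virtual n m) :
    ∃ w' ∈ virtual n m, w * w' = 1 ∧ w' * w = 1 := by
  induction hw using Submonoid.closure_induction with
  | mem x hx =>
    obtain ⟨j, hj, rfl⟩ := hx
    exact ⟨_, vAt_mem_virtual hj, vAt_mul_self j, vAt_mul_self j⟩
  | one => exact ⟨1, one_mem _, by simp, by simp⟩
  | mul x y _ _ hx hy =>
    obtain ⟨x', hx', h1, h2⟩ := hx
    obtain ⟨y', hy', h3, h4⟩ := hy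
    refine ⟨y' * x', mul_mem hy' hx', ?_, ?_⟩
    · rw [mul_assoc, ← mul_assoc y, h3, one_mul, h1]
    · rw [mul_assoc, ← mul_assoc x', h2, one_mul, h4]

theorem perm_apply_of_mem_virtual {m : ℕ} (hm : m < n) {w : VSB n} (hw : w ∈ virtual n (m + 1)) :
    perm n w ⟨m, hm⟩ = ⟨m, hm⟩ := by
  induction hw using Submonoid.closure_induction with
  | mem x hx =>
    obtain ⟨j, hj, rfl⟩ := hx
    exact perm_vAt_of_lt_apply hj hm
  | one => simp
  | mul x y _ _ hx hy => rw [map_mul, Equiv.Perm.mul_apply, hy, hx]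

/-- The product `v_m v_{m+1} ⋯ v_{m+r-1}`. -/
def chain (n m : ℕ) : ℕ → VSB n
  | 0 => 1
  | r + 1 => chain n m r * vAt n (m + r)

theorem chain_mul_vAt_of_gt {m r j : ℕ} (h : m + r < j) :
    chain n m r * vAt n j = vAt n j * chain n m r := by
  induction r with
  | zero => simp [chain]
  | succ r ih =>
    rw [chain, mul_assoc, vAt_far (.inl (by omega)), ← mul_assoc, ih (by omega), mul_assoc]

theorem chain_mul_vAt_of_lt {m r j : ℕ} (hmj : m ≤ j) (hj : j + 1 < m + r) (hr : m + r < n) :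
    chain n m r * vAt n j = vAt n (j + 1) * chain n m r := by
  induction r with
  | zero => omega
  | succ r ih =>
    by_cases h : j + 1 < m + r
    · rw [chain, mul_assoc, vAt_far (.inr h), ← mul_assoc, ih h (by omega), mul_assoc]
    · obtain ⟨s, rfl⟩ : ∃ s, r = s + 1 := ⟨r - 1, by omega⟩
      obtain rfl : j = m + s := by omega
      have hb := vAt_braid (n := n) (i := m + s) (by omega)
      rw [chain, chain, ← add_assoc, mul_assoc, mul_assoc, ← mul_assoc (vAt n (m + s)), hb,
        ← mul_assoc, ← mul_assoc, chain_mul_vAt_of_gt (by omega)]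
      simp only [mul_assoc]

theorem perm_chain_apply {m r : ℕ} (hr : m + r < n) :
    perm n (chain n m r) ⟨m + r, hr⟩ = ⟨m, by omega⟩ := by
  induction r with
  | zero => simp [chain]
  | succ r ih =>
    rw [chain, map_mul, Equiv.Perm.mul_apply, perm_vAt_of_lt (j := m + r) hr]
    exact (congrArg _ (Equiv.swap_apply_right _ _)).trans (ih (by omega))

/-- The normal form of a virtual braid: each coset of `virtual n (m + 1)` in `virtual n m` is
represented by one of the `n - m` products `v_m v_{m+1} ⋯ v_{m+r-1}`. -/
theorem exists_eq_mul_chain {m : ℕ} (hm : m < n) {w : VSB n} (hw : w ∈ virtual n m) :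
    ∃ w' ∈ virtual n (m + 1), ∃ r, m + r < n ∧ w = w' * chain n m r := by
  induction hw using Submonoid.closure_induction_right with
  | one => exact ⟨1, one_mem _, 0, hm, by simp [chain]⟩
  | mul_right x hx y hy ih =>
    obtain ⟨w, hw, r, hr, rfl⟩ := ih
    obtain ⟨j, hj, rfl⟩ := hy
    rw [Set.mem_Ici] at hj
    by_cases hjn : j < n - 1
    · rcases lt_trichotomy j (m + r) with h | rfl | h
      · by_cases h' : j + 1 < m + r
        · refine ⟨w * vAt n (j + 1), mul_mem hw (vAt_mem_virtual (by omega)), r, hr, ?_⟩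
          rw [mul_assoc, chain_mul_vAt_of_lt hj h' hr, mul_assoc]
        · obtain ⟨s, rfl⟩ : ∃ s, r = s + 1 := ⟨r - 1, by omega⟩
          obtain rfl : j = m + s := by omega
          refine ⟨w, hw, s, by omega, ?_⟩
          rw [chain, mul_assoc, mul_assoc, vAt_mul_self, mul_one]
      · exact ⟨w, hw, r + 1, by omega, by rw [chain, mul_assoc]⟩
      · refine ⟨w * vAt n j, mul_mem hw (vAt_mem_virtual (by omega)), r, hr, ?_⟩
        rw [mul_assoc, chain_mul_vAt_of_gt h, mul_assoc]
    · exact ⟨w, hw, r, hr, by rw [vAt_of_not_lt hjn, mul_one]⟩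

/-- The stabilizer of `m` in the virtual braids on the strands `m, m + 1, …` consists of the virtual
braids on the strands `m + 1, m + 2, …`. -/
theorem mem_virtual_succ {m : ℕ} (hm : m < n) {w : VSB n} (hw : w ∈ virtual n m)
    (h : perm n w ⟨m, hm⟩ = ⟨m, hm⟩) : w ∈ virtual n (m + 1) := by
  obtain ⟨w', hw', r, hr, rfl⟩ := exists_eq_mul_chain hm hw
  have h1 : perm n (w' * chain n m r) ⟨m + r, hr⟩ = ⟨m, hm⟩ := by
    rw [map_mul, Equiv.Perm.mul_apply, perm_chain_apply, perm_apply_of_mem_virtual hm hw']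
  have h2 := congrArg Fin.val ((perm n (w' * chain n m r)).injective (h1.trans h.symm))
  obtain rfl : r = 0 := by simpa using h2
  simpa [chain] using hw'

theorem virtual_eq_bot : virtual n n = ⊥ := by
  rw [virtual, eq_bot_iff, Submonoid.closure_le]
  rintro _ ⟨j, hj, rfl⟩
  rw [Set.mem_Ici] at hj
  exact vAt_of_not_lt (by omega)

theorem eq_one_of_perm_eq_one {w : VSB n} (hw : w ∈ virtual n 0) (h : perm n w = 1) : w = 1 := by
  have key : ∀ m ≤ n, w ∈ virtual n m := by
    intro m
    induction m with
    | zero => exact fun _ => hw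
    | succ m ih =>
      intro hm
      exact mem_virtual_succ hm (ih (by omega)) (by rw [h]; rfl)
  have := key n le_rfl
  rwa [virtual_eq_bot, Submonoid.mem_bot] at this

/-- The Coxeter presentation of the symmetric group. -/
theorem perm_bijective_virtual :
    Function.Bijective ((perm n).comp (virtual n 0).subtype) := by
  constructor
  · rintro ⟨w, hw⟩ ⟨w', hw'⟩ h
    obtain ⟨u, hu, h1, h2⟩ := exists_inverse_of_mem_virtual hw'
    have h3 : perm n (w * u) = 1 := by
      rw [← map_one (perm n), ← h1, map_mul, map_mul]
      exact congrArg (· * perm n u) h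
    have h4 := eq_one_of_perm_eq_one (mul_mem hw hu) h3
    apply Subtype.ext
    calc w = w * u * w' := by rw [mul_assoc, h2, mul_one]
      _ = w' := by rw [h4, one_mul]
  · rw [← MonoidHom.mrange_eq_top]
    rcases n with _ | n
    · exact Subsingleton.elim _ _
    · rw [eq_top_iff, ← Equiv.Perm.mclosure_swap_castSucc_succ, Submonoid.closure_le]
      rintro _ ⟨i, rfl⟩
      refine ⟨⟨vAt (n + 1) i, vAt_mem_virtual (Nat.zero_le _)⟩, ?_⟩
      exact perm_vAt_of_lt (by omega)

/-- The section `S_n → VSB_n` of `perm` with values in the virtual braids. -/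
noncomputable def permLift (n : ℕ) : Equiv.Perm (Fin n) →* VSB n :=
  (virtual n 0).subtype.comp
    (MulEquiv.ofBijective ((perm n).comp (virtual n 0).subtype) perm_bijective_virtual).symm

theorem permLift_mem (s : Equiv.Perm (Fin n)) : permLift n s ∈ virtual n 0 := Subtype.property _

@[simp]
theorem perm_permLift (s : Equiv.Perm (Fin n)) : perm n (permLift n s) = s :=
  (MulEquiv.ofBijective ((perm n).comp (virtual n 0).subtype)
    perm_bijective_virtual).apply_symm_apply s

theorem permLift_perm {w : VSB n} (hw : w ∈ virtual n 0) : permLift n (perm n w) = w :=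
  congrArg Subtype.val ((MulEquiv.ofBijective ((perm n).comp (virtual n 0).subtype)
    perm_bijective_virtual).symm_apply_apply ⟨w, hw⟩)

theorem permLift_perm_vAt (j : ℕ) : permLift n (perm n (vAt n j)) = vAt n j :=
  permLift_perm (vAt_mem_virtual (Nat.zero_le j))

theorem permLift_transposition (i : Fin (n - 1)) : permLift n (transposition i) = vAt n i := by
  rw [← permLift_perm_vAt, ← braid_v]
  rfl

theorem permLift_mul_permLift_inv (s : Equiv.Perm (Fin n)) : permLift n s * permLift n s⁻¹ = 1 := by
  rw [← map_mul, mul_inv_cancel, map_one]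

theorem permLift_inv_mul_permLift (s : Equiv.Perm (Fin n)) : permLift n s⁻¹ * permLift n s = 1 := by
  rw [← map_mul, inv_mul_cancel, map_one]

/-! ### Generalized strings as conjugates of one elementary string -/

/-- The action of `S_n` on `VSB_n` by conjugation with virtual braids. -/
noncomputable def conj (n : ℕ) : Equiv.Perm (Fin n) →* Monoid.End (VSB n) where
  toFun s :=
    { toFun := fun x => permLift n s * x * permLift n s⁻¹
      map_one' := by rw [mul_one, permLift_mul_permLift_inv]
      map_mul' := fun x y => by
        simp only [mul_assoc]
        rw [← mul_assoc (permLift n s⁻¹), permLift_inv_mul_permLift, one_mul] }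
  map_one' := MonoidHom.ext fun x => by
    change permLift n 1 * x * permLift n 1⁻¹ = x
    simp
  map_mul' s t := MonoidHom.ext fun x => by
    change permLift n (s * t) * x * permLift n (s * t)⁻¹ =
      permLift n s * (permLift n t * x * permLift n t⁻¹) * permLift n s⁻¹
    simp only [mul_inv_rev, map_mul, mul_assoc]

theorem conj_apply (s : Equiv.Perm (Fin n)) (x : VSB n) :
    conj n s x = permLift n s * x * permLift n s⁻¹ := rfl

theorem conj_mul_apply (s t : Equiv.Perm (Fin n)) (x : VSB n) :
    conj n (s * t) x = conj n s (conj n t x) := by rw [map_mul]; rfl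

theorem conj_transposition (i : Fin (n - 1)) (x : VSB n) :
    conj n (transposition i) x = vAt n i * x * vAt n i := by
  rw [conj_apply, inv_eq_of_mul_eq_one_left (transposition_sq i), permLift_transposition]

theorem commute_of_mem_virtual {m : ℕ} {x w : VSB n}
    (hx : ∀ j, m ≤ j → vAt n j * x = x * vAt n j) (hw : w ∈ virtual n m) : w * x = x * w := by
  induction hw using Submonoid.closure_induction with
  | mem y hy =>
    obtain ⟨j, hj, rfl⟩ := hy
    exact hx j hj
  | one => simp
  | mul y z _ _ hy hz => rw [mul_assoc, hz, ← mul_assoc, hy, mul_assoc]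

/-- The relations between the `v_j` and the elementary strings `x_i` which make the generalized
strings `x_{kl}` conjugates of each other under the virtual braids. -/
structure IsStringFamily (x : Fin (n - 1) → VSB n) : Prop where
  shift (i j : Fin (n - 1)) (h : i.val + 1 = j.val) :
    x j = vAt n i * (vAt n j * x i * vAt n j) * vAt n i
  comm (i : Fin (n - 1)) (j : ℕ) (h : i.val + 1 < j) : vAt n j * x i = x i * vAt n j

namespace IsStringFamily

variable {x : Fin (n - 1) → VSB n}

theorem conj_eq_self (hx : IsStringFamily x) (hn : 2 ≤ n) {s : Equiv.Perm (Fin n)}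
    (h0 : s ⟨0, by omega⟩ = ⟨0, by omega⟩) (h1 : s ⟨1, by omega⟩ = ⟨1, by omega⟩) :
    conj n s (x ⟨0, by omega⟩) = x ⟨0, by omega⟩ := by
  have h2 : permLift n s ∈ virtual n 2 :=
    mem_virtual_succ _ (mem_virtual_succ _ (permLift_mem s) (by rwa [perm_permLift]))
      (by rwa [perm_permLift])
  rw [conj_apply, commute_of_mem_virtual (fun j hj => hx.comm ⟨0, by omega⟩ j hj) h2, mul_assoc,
    permLift_mul_permLift_inv, mul_one]

theorem conj_eq_conj (hx : IsStringFamily x) (hn : 2 ≤ n) {s t : Equiv.Perm (Fin n)}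
    (h0 : s ⟨0, by omega⟩ = t ⟨0, by omega⟩) (h1 : s ⟨1, by omega⟩ = t ⟨1, by omega⟩) :
    conj n s (x ⟨0, by omega⟩) = conj n t (x ⟨0, by omega⟩) := by
  have h : conj n (t⁻¹ * s) (x ⟨0, by omega⟩) = x ⟨0, by omega⟩ := by
    apply hx.conj_eq_self hn <;> simp [h0, h1]
  rw [← mul_inv_cancel_left t s, conj_mul_apply, h]

theorem exists_conj_elem (hx : IsStringFamily x) (hn : 2 ≤ n) (i : ℕ) (hi : i < n - 1) :
    ∃ s : Equiv.Perm (Fin n), s ⟨0, by omega⟩ = ⟨i, by omega⟩ ∧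
      s ⟨1, by omega⟩ = ⟨i + 1, by omega⟩ ∧ x ⟨i, hi⟩ = conj n s (x ⟨0, by omega⟩) := by
  induction i with
  | zero => exact ⟨1, rfl, rfl, by simp⟩
  | succ i ih =>
    obtain ⟨s, h0, h1, h2⟩ := ih (by omega)
    let a : Fin (n - 1) := ⟨i, by omega⟩
    let b : Fin (n - 1) := ⟨i + 1, hi⟩
    refine ⟨transposition a * transposition b * s, ?_, ?_, ?_⟩
    · simp [Equiv.Perm.mul_apply, h0, transposition, Equiv.swap_apply_def, a, b]
      omega
    · simp [Equiv.Perm.mul_apply, h1, transposition, Equiv.swap_apply_def, a, b]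
      omega
    · rw [conj_mul_apply, ← h2, conj_mul_apply, conj_transposition, conj_transposition]
      exact hx.shift a b rfl

end IsStringFamily

theorem ascend_succ {k l : ℕ} (h : k < l) : ascend n k (l + 1) = ascend n k l * vAt n l := by
  obtain ⟨d, rfl⟩ : ∃ d, l = k + 1 + d := ⟨l - (k + 1), by omega⟩
  rw [ascend, ascend, show k + 1 + d + 1 - (k + 1) = d + 1 by omega,
    show k + 1 + d - (k + 1) = d by omega, List.range'_concat]
  simp

theorem descend_succ {k l : ℕ} (h : k < l) : descend n k (l + 1) = vAt n l * descend n k l := by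
  obtain ⟨d, rfl⟩ : ∃ d, l = k + 1 + d := ⟨l - (k + 1), by omega⟩
  rw [descend, descend, show k + 1 + d + 1 - (k + 1) = d + 1 by omega,
    show k + 1 + d - (k + 1) = d by omega, List.range'_concat]
  simp

/-- The virtual braid `v_{l-1} ⋯ v_{k+1}` fixes `k` and takes `k + 1` to `l`, and
`v_{k+1} ⋯ v_{l-1}` is its inverse. -/
theorem exists_conj_descend (k l : ℕ) (hkl : k < l) (hl : l < n) :
    ∃ s : Equiv.Perm (Fin n), s ⟨k, by omega⟩ = ⟨k, by omega⟩ ∧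
      s ⟨k + 1, by omega⟩ = ⟨l, hl⟩ ∧
      ∀ y, descend n k l * y * ascend n k l = conj n s y := by
  induction l, hkl using Nat.le_induction with
  | base => exact ⟨1, rfl, rfl, fun y => by simp [descend, ascend]⟩
  | succ l hkl ih =>
    rw [Nat.succ_le_iff] at hkl
    obtain ⟨s, h0, h1, h2⟩ := ih (by omega)
    refine ⟨transposition ⟨l, by omega⟩ * s, ?_, ?_, fun y => ?_⟩
    · rw [Equiv.Perm.mul_apply, h0, transposition]
      apply Equiv.swap_apply_of_ne_of_ne <;> simp <;> omega
    · rw [Equiv.Perm.mul_apply, h1, transposition, Equiv.swap_apply_left]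
    · rw [conj_mul_apply, ← h2, conj_transposition, ascend_succ hkl, descend_succ hkl]
      simp only [mul_assoc]

/-- A generalized string `x_{kl}` is the conjugate of `x_0` by any permutation taking `0` to `k` and
`1` to `l`: for the one implicit in its definition this is a computation, and two such permutations
differ by one fixing `0` and `1`. -/
theorem IsStringFamily.generalized_eq {x : Fin (n - 1) → VSB n} (hx : IsStringFamily x)
    (hn : 2 ≤ n) (k l : Fin n) (hkl : k ≠ l) {s : Equiv.Perm (Fin n)}
    (h0 : s ⟨0, by omega⟩ = k) (h1 : s ⟨1, by omega⟩ = l) :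
    generalized x k l hkl = conj n s (x ⟨0, by omega⟩) := by
  by_cases h : k < l
  · obtain ⟨t, ht0, ht1, ht⟩ := exists_conj_descend (n := n) k l h l.isLt
    obtain ⟨u, hu0, hu1, hu⟩ := hx.exists_conj_elem hn k (by omega)
    rw [generalized, dif_pos h, ht, hu, ← conj_mul_apply]
    apply hx.conj_eq_conj hn
    · rw [Equiv.Perm.mul_apply, hu0, ht0, h0]
    · rw [Equiv.Perm.mul_apply, hu1, ht1, h1]
  · obtain ⟨t, ht0, ht1, ht⟩ := exists_conj_descend (n := n) l k (by omega) k.isLt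
    obtain ⟨u, hu0, hu1, hu⟩ := hx.exists_conj_elem hn l (by omega)
    rw [generalized, dif_neg h, ht, braid_v, ← conj_transposition, hu, ← conj_mul_apply,
      ← conj_mul_apply]
    apply hx.conj_eq_conj hn
    · rw [Equiv.Perm.mul_apply, Equiv.Perm.mul_apply, hu0, transposition, Equiv.swap_apply_left,
        ht1, h0]
    · rw [Equiv.Perm.mul_apply, Equiv.Perm.mul_apply, hu1, transposition, Equiv.swap_apply_right,
        ht0, h1]

theorem exists_perm_extending {m : ℕ} {f : Fin m → Fin n} (hf : f.Injective) :
    ∃ (hm : m ≤ n) (s : Equiv.Perm (Fin n)), ∀ a, s (Fin.castLE hm a) = f a := by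
  have hm : m ≤ n := by simpa using Fintype.card_le_of_injective f hf
  have := Equiv.Perm.isMultiplyPretransitive (Fin n) m
  obtain ⟨s, hs⟩ := MulAction.exists_smul_eq (M := Equiv.Perm (Fin n)) (Fin.castLEEmb hm) ⟨f, hf⟩
  exact ⟨hm, s, fun a => DFunLike.congr_fun hs a⟩

theorem exists_perm_pair (hn : 2 ≤ n) {k l : Fin n} (hkl : k ≠ l) :
    ∃ s : Equiv.Perm (Fin n), s ⟨0, by omega⟩ = k ∧ s ⟨1, by omega⟩ = l := by
  obtain ⟨_, s, hs⟩ := exists_perm_extending (f := ![k, l]) (by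
    simp [Function.Injective, Fin.forall_fin_succ, hkl, hkl.symm])
  exact ⟨s, hs 0, hs 1⟩

/-- Conjugation by virtual braids permutes the indices of generalized strings. -/
theorem IsStringFamily.conj_generalized {x : Fin (n - 1) → VSB n} (hx : IsStringFamily x)
    (hn : 2 ≤ n) (k l : Fin n) (hkl : k ≠ l) (t : Equiv.Perm (Fin n)) :
    conj n t (generalized x k l hkl) = generalized x (t k) (t l) (t.injective.ne hkl) := by
  obtain ⟨s, h0, h1⟩ := exists_perm_pair hn hkl
  rw [hx.generalized_eq hn k l hkl h0 h1, ← conj_mul_apply]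
  symm
  apply hx.generalized_eq hn <;> simp [h0, h1]

/-! ### The elementary fusing strings -/

variable {i j : Fin (n - 1)}

theorem sigma_mul_sigmaInv (i : Fin (n - 1)) : braid (.sigma i) * braid (.sigmaInv i) = 1 :=
  PresentedMonoid.mk_eq_mk_of_rel (.sigma_inv i)

theorem sigmaInv_mul_sigma (i : Fin (n - 1)) : braid (.sigmaInv i) * braid (.sigma i) = 1 :=
  PresentedMonoid.mk_eq_mk_of_rel (.inv_sigma i)

theorem sigma_shift (h : Adjacent i j) :
    vAt n i * braid (.sigma j) * vAt n i = vAt n j * braid (.sigma i) * vAt n j := by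
  rw [← braid_v, ← braid_v]
  exact PresentedMonoid.mk_eq_mk_of_rel (.vr3 i j h)

theorem tau_shift (h : Adjacent i j) :
    vAt n i * braid (.tau j) * vAt n i = vAt n j * braid (.tau i) * vAt n j := by
  rw [← braid_v, ← braid_v]
  exact PresentedMonoid.mk_eq_mk_of_rel (.vs3 i j h)

theorem commute_of_inverse {M : Type*} [Monoid M] {a b c : M} (hab : a * b = 1) (hba : b * a = 1)
    (h : c * a = a * c) : c * b = b * c :=
  calc c * b = b * a * c * b := by rw [hba, one_mul]
    _ = b * c := by rw [mul_assoc b, ← h, mul_assoc, mul_assoc, hab, mul_one]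

theorem sigmaInv_shift (h : Adjacent i j) :
    vAt n i * braid (.sigmaInv j) * vAt n i = vAt n j * braid (.sigmaInv i) * vAt n j := by
  refine left_inv_eq_right_inv (a := vAt n i * braid (.sigma j) * vAt n i) ?_ ?_
  · simp only [mul_assoc, vAt_mul_cancel]
    rw [← mul_assoc (braid (.sigmaInv j)), sigmaInv_mul_sigma, one_mul, vAt_mul_self]
  · rw [sigma_shift h]
    simp only [mul_assoc, vAt_mul_cancel]
    rw [← mul_assoc (braid (.sigma i)), sigma_mul_sigmaInv, one_mul, vAt_mul_self]

theorem vAt_comm_gen {g : Fin (n - 1) → BraidGen n} (hg : g = .sigma ∨ g = .tau ∨ g = .v)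
    {j : ℕ} (h : i.val + 1 < j) : vAt n j * braid (g i) = braid (g i) * vAt n j := by
  by_cases hj : j < n - 1
  · rw [vAt_of_lt hj]
    exact PresentedMonoid.mk_eq_mk_of_rel (.comm .v g (.inr (.inr rfl)) hg ⟨j, hj⟩ i (.inr h))
  · simp [vAt_of_not_lt hj]

/-- If `g_i` obeys the mixed relations with the `v_j`, then so does `g_i v_i`. -/
theorem isStringFamily_mul_v {g : Fin (n - 1) → VSB n}
    (hs : ∀ i j : Fin (n - 1), Adjacent i j → vAt n i * g j * vAt n i = vAt n j * g i * vAt n j)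
    (hc : ∀ (i : Fin (n - 1)) (j : ℕ), i.val + 1 < j → vAt n j * g i = g i * vAt n j) :
    IsStringFamily fun i => g i * vAt n i where
  shift i j h := by
    have h1 : g j = vAt n i * (vAt n j * g i * vAt n j) * vAt n i := by
      rw [← hs i j (.inl h)]
      simp only [mul_assoc, vAt_mul_cancel, vAt_mul_self, mul_one]
    have h2 := vAt_braid (n := n) (i := i.val) (by omega)
    rw [h, mul_assoc, mul_assoc] at h2
    simp only [h1, mul_assoc]
    rw [← h2]
  comm i j h := by
    rw [← mul_assoc, hc i j h, mul_assoc, mul_assoc, vAt_far (.inr h)]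

theorem isStringFamily_v_mul {g : Fin (n - 1) → VSB n}
    (hs : ∀ i j : Fin (n - 1), Adjacent i j → vAt n i * g j * vAt n i = vAt n j * g i * vAt n j)
    (hc : ∀ (i : Fin (n - 1)) (j : ℕ), i.val + 1 < j → vAt n j * g i = g i * vAt n j) :
    IsStringFamily fun i => vAt n i * g i where
  shift i j h := by
    have h1 : g j = vAt n i * (vAt n j * g i * vAt n j) * vAt n i := by
      rw [← hs i j (.inl h)]
      simp only [mul_assoc, vAt_mul_cancel, vAt_mul_self, mul_one]
    have h2 := vAt_braid (n := n) (i := i.val) (by omega)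
    rw [h] at h2
    simp only [h1, ← mul_assoc]
    rw [← h2]
  comm i j h := by
    rw [← mul_assoc, vAt_far (.inr h), mul_assoc, mul_assoc, hc i j h]

theorem isStringFamily_elemMu : IsStringFamily (elemMu (n := n)) := by
  have := isStringFamily_mul_v (n := n) (fun _ _ => sigma_shift) fun i j =>
    vAt_comm_gen (.inl rfl)
  simp only [← braid_v] at this
  exact this

theorem isStringFamily_elemMuInv : IsStringFamily (elemMuInv (n := n)) := by
  have := isStringFamily_v_mul (n := n) (fun _ _ => sigmaInv_shift) fun i j h =>
    commute_of_inverse (sigma_mul_sigmaInv i) (sigmaInv_mul_sigma i)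
      (vAt_comm_gen (.inl rfl) h)
  simp only [← braid_v] at this
  exact this

theorem isStringFamily_elemGamma : IsStringFamily (elemGamma (n := n)) := by
  have := isStringFamily_mul_v (n := n) (fun _ _ => tau_shift) fun i j =>
    vAt_comm_gen (.inr (.inl rfl))
  simp only [← braid_v] at this
  exact this

/-- The renumbering of the indices of a letter by a permutation. -/
def PureGen.map (s : Equiv.Perm (Fin n)) : PureGen n → PureGen n
  | .mu k l h => .mu (s k) (s l) (s.injective.ne h)
  | .muInv k l h => .muInv (s k) (s l) (s.injective.ne h)
  | .gamma k l h => .gamma (s k) (s l) (s.injective.ne h)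

theorem conj_fusing (hn : 2 ≤ n) (s : Equiv.Perm (Fin n)) (g : PureGen n) :
    conj n s (fusing g) = fusing (g.map s) := by
  cases g with
  | mu k l h => exact isStringFamily_elemMu.conj_generalized hn k l h s
  | muInv k l h => exact isStringFamily_elemMuInv.conj_generalized hn k l h s
  | gamma k l h => exact isStringFamily_elemGamma.conj_generalized hn k l h s

/-! ### The relations between the fusing strings -/

/-- The lower one `i` of the strands crossed by an elementary braid. -/
def lower (i : Fin (n - 1)) : Fin n := ⟨i.val, by omega⟩

/-- The upper one `i + 1` of the strands crossed by an elementary braid. -/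
def upper (i : Fin (n - 1)) : Fin n := ⟨i.val + 1, by omega⟩

theorem lower_ne_upper (i : Fin (n - 1)) : lower i ≠ upper i := by simp [lower, upper]

theorem generalized_lt {x : Fin (n - 1) → VSB n} {k l : Fin n} {i : Fin (n - 1)} {h : k ≠ l}
    (hk : k.val = i.val) (hl : l.val = i.val + 1) : generalized x k l h = x i := by
  have h1 : k < l := by rw [Fin.lt_def]; omega
  have h2 : (⟨k.val, by omega⟩ : Fin (n - 1)) = i := Fin.ext hk
  rw [generalized, dif_pos h1, h2]
  simp [descend, ascend, hk, hl]

theorem generalized_gt {x : Fin (n - 1) → VSB n} {k l : Fin n} {i : Fin (n - 1)} {h : k ≠ l}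
    (hl : l.val = i.val) (hk : k.val = i.val + 1) :
    generalized x k l h = vAt n i * x i * vAt n i := by
  have h1 : ¬ k < l := by rw [Fin.lt_def]; omega
  have h2 : (⟨l.val, by omega⟩ : Fin (n - 1)) = i := Fin.ext hl
  rw [generalized, dif_neg h1, h2, braid_v]
  simp [descend, ascend, hk, hl]

theorem generalized_lower_upper (x : Fin (n - 1) → VSB n) (i : Fin (n - 1)) :
    generalized x _ _ (lower_ne_upper i) = x i := generalized_lt rfl rfl

section

variable {x y z : Fin (n - 1) → VSB n}

/-- A relation of Yang–Baxter type between generalized strings follows from its case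
`(i, j, k) = (0, 1, 2)`, since `S_n` acts transitively on triples of distinct indices. -/
theorem yangBaxter_generalized (hx : IsStringFamily x) (hy : IsStringFamily y)
    (hz : IsStringFamily z)
    (hxyz : ∀ a b : Fin (n - 1), a.val + 1 = b.val →
      x a * (vAt n a * y b * vAt n a) * z b = z b * (vAt n b * y a * vAt n b) * x a)
    (i j k : Fin n) (hij : i ≠ j) (hik : i ≠ k) (hjk : j ≠ k) :
    generalized x i j hij * generalized y i k hik * generalized z j k hjk =
      generalized z j k hjk * generalized y i k hik * generalized x i j hij := by
  obtain ⟨hn, s, hs⟩ := exists_perm_extending (f := ![i, j, k]) (by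
    simp [Function.Injective, Fin.forall_fin_succ, hij, hik, hjk, hij.symm, hik.symm, hjk.symm])
  obtain rfl : s ⟨0, by omega⟩ = i := hs 0
  obtain rfl : s ⟨1, by omega⟩ = j := hs 1
  obtain rfl : s ⟨2, by omega⟩ = k := hs 2
  have hn2 : 2 ≤ n := by omega
  let a : Fin (n - 1) := ⟨0, by omega⟩
  let b : Fin (n - 1) := ⟨1, by omega⟩
  have h02 : (⟨0, by omega⟩ : Fin n) ≠ ⟨2, by omega⟩ := by simp
  have h12 : (⟨1, by omega⟩ : Fin n) ≠ ⟨2, by omega⟩ := by simp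
  have h01 : (⟨0, by omega⟩ : Fin n) ≠ ⟨1, by omega⟩ := by simp
  have hx01 : generalized x _ _ h01 = x a := generalized_lt rfl rfl
  have hz12 : generalized z _ _ h12 = z b := generalized_lt rfl rfl
  -- The string `y_{02}` arises from `y_{12}` by `v_0` as well as from `y_{01}` by `v_1`.
  have hy02 : generalized y _ _ h02 = vAt n a * y b * vAt n a := by
    rw [← generalized_lt (x := y) (i := b) (h := h12) rfl rfl, ← conj_transposition,
      hy.conj_generalized hn2]
    congr 1
  have hy02' : generalized y _ _ h02 = vAt n b * y a * vAt n b := by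
    rw [← generalized_lt (x := y) (i := a) (h := h01) rfl rfl, ← conj_transposition,
      hy.conj_generalized hn2]
    congr 1
  rw [← hx.conj_generalized hn2 _ _ h01, ← hy.conj_generalized hn2 _ _ h02,
    ← hz.conj_generalized hn2 _ _ h12]
  simp only [← map_mul]
  rw [hx01, hz12]
  nth_rw 1 [hy02]
  rw [hy02', hxyz a b rfl]

/-- Strings with disjoint indices commute as soon as they do so for the indices
`(i, j, k, l) = (0, 1, 2, 3)`. -/
theorem commute_generalized (hx : IsStringFamily x) (hy : IsStringFamily y)
    (hxy : ∀ a b : Fin (n - 1), Far a b → x a * y b = y b * x a)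
    (i j k l : Fin n) (hij : i ≠ j) (hkl : k ≠ l)
    (hik : i ≠ k) (hil : i ≠ l) (hjk : j ≠ k) (hjl : j ≠ l) :
    generalized x i j hij * generalized y k l hkl =
      generalized y k l hkl * generalized x i j hij := by
  obtain ⟨hn, s, hs⟩ := exists_perm_extending (f := ![i, j, k, l]) (by
    simp [Function.Injective, Fin.forall_fin_succ, hij, hik, hjk, hil, hjl, hkl, hij.symm,
      hik.symm, hjk.symm, hil.symm, hjl.symm, hkl.symm])
  obtain rfl : s ⟨0, by omega⟩ = i := hs 0
  obtain rfl : s ⟨1, by omega⟩ = j := hs 1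
  obtain rfl : s ⟨2, by omega⟩ = k := hs 2
  obtain rfl : s ⟨3, by omega⟩ = l := hs 3
  have hn2 : 2 ≤ n := by omega
  let a : Fin (n - 1) := ⟨0, by omega⟩
  let b : Fin (n - 1) := ⟨2, by omega⟩
  have h01 : (⟨0, by omega⟩ : Fin n) ≠ ⟨1, by omega⟩ := by simp
  have h23 : (⟨2, by omega⟩ : Fin n) ≠ ⟨3, by omega⟩ := by simp
  have hx01 : generalized x _ _ h01 = x a := generalized_lt rfl rfl
  have hy23 : generalized y _ _ h23 = y b := generalized_lt rfl rfl
  rw [← hx.conj_generalized hn2 _ _ h01, ← hy.conj_generalized hn2 _ _ h23, ← map_mul, ← map_mul,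
    hx01, hy23, hxy a b (.inl (by simp [a, b]))]

end

/-- Pulling all `v` to the right turns a braid relation for `g, h, k` into the Yang–Baxter relation
for the strings `g_i v_i`, `h_i v_i`, `k_i v_i`. -/
theorem yangBaxter_elem {g h k : Fin (n - 1) → VSB n} {a b : Fin (n - 1)} (hab : a.val + 1 = b.val)
    (hg : vAt n a * g b * vAt n a = vAt n b * g a * vAt n b)
    (hk : vAt n a * k b * vAt n a = vAt n b * k a * vAt n b)
    (hghk : g a * h b * k a = k b * h a * g b) :
    g a * vAt n a * (vAt n a * (h b * vAt n b) * vAt n a) * (k b * vAt n b) =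
      k b * vAt n b * (vAt n b * (h a * vAt n a) * vAt n b) * (g a * vAt n a) := by
  have hb := vAt_braid (n := n) (i := a.val) (by omega)
  rw [hab] at hb
  have h1 : vAt n b * (vAt n a * k b) = k a * (vAt n b * vAt n a) := by
    calc _ = vAt n b * (vAt n a * k b * vAt n a) * vAt n a := by
          simp only [mul_assoc, vAt_mul_self, mul_one]
      _ = _ := by rw [hk]; simp only [mul_assoc, vAt_mul_cancel]
  have h2 : vAt n a * (vAt n b * g a) = g b * (vAt n a * vAt n b) := by
    calc _ = vAt n a * (vAt n b * g a * vAt n b) * vAt n b := by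
          simp only [mul_assoc, vAt_mul_self, mul_one]
      _ = _ := by rw [← hg]; simp only [mul_assoc, vAt_mul_cancel]
  calc _ = g a * h b * (vAt n b * (vAt n a * k b)) * vAt n b := by
        simp only [mul_assoc, vAt_mul_cancel]
    _ = g a * h b * k a * (vAt n b * vAt n a * vAt n b) := by rw [h1]; simp only [mul_assoc]
    _ = k b * h a * (g b * (vAt n a * vAt n b)) * vAt n a := by
        rw [hghk, ← hb]; simp only [mul_assoc]
    _ = _ := by rw [← h2]; simp only [mul_assoc, vAt_mul_cancel]

theorem sigma_sigma_sigma {i j : Fin (n - 1)} (h : Adjacent i j) :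
    (braid (.sigma i) * braid (.sigma j) * braid (.sigma i) : VSB n) =
      braid (.sigma j) * braid (.sigma i) * braid (.sigma j) :=
  PresentedMonoid.mk_eq_mk_of_rel (.r3 i j h)

theorem sigma_sigma_tau {i j : Fin (n - 1)} (h : Adjacent i j) :
    (braid (.sigma i) * braid (.sigma j) * braid (.tau i) : VSB n) =
      braid (.tau j) * braid (.sigma i) * braid (.sigma j) :=
  PresentedMonoid.mk_eq_mk_of_rel (.rs3 i j h)

theorem sigma_tau (i : Fin (n - 1)) :
    (braid (.sigma i) * braid (.tau i) : VSB n) = braid (.tau i) * braid (.sigma i) :=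
  PresentedMonoid.mk_eq_mk_of_rel (.rs1 i)

theorem commute_elem {g h : Fin (n - 1) → BraidGen n} (hg : g = .sigma ∨ g = .tau ∨ g = .v)
    (hh : h = .sigma ∨ h = .tau ∨ h = .v) {a b : Fin (n - 1)} (hab : Far a b) :
    (braid (g a) * braid (.v a) * (braid (h b) * braid (.v b)) : VSB n) =
      braid (h b) * braid (.v b) * (braid (g a) * braid (.v a)) := by
  have comm {g h : Fin (n - 1) → BraidGen n} (hg : g = .sigma ∨ g = .tau ∨ g = .v)
      (hh : h = .sigma ∨ h = .tau ∨ h = .v) : Commute (braid (g a) : VSB n) (braid (h b)) :=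
    PresentedMonoid.mk_eq_mk_of_rel (.comm g h hg hh a b hab)
  have hv : (BraidGen.v : Fin (n - 1) → BraidGen n) = .sigma ∨
    (BraidGen.v : Fin (n - 1) → BraidGen n) = .tau ∨
    (BraidGen.v : Fin (n - 1) → BraidGen n) = .v := .inr (.inr rfl)
  exact ((comm hg hh).mul_left (comm hv hh)).mul_right ((comm hg hv).mul_left (comm hv hv))

theorem fusing_mul_inv (hn : 2 ≤ n) (k l : Fin n) (h : k ≠ l) :
    fusing (.mu k l h) * fusing (.muInv k l h) = 1 ∧
      fusing (.muInv k l h) * fusing (.mu k l h) = 1 := by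
  obtain ⟨s, h0, h1⟩ := exists_perm_pair hn h
  have hmu : fusing (.mu k l h) = _ := isStringFamily_elemMu.generalized_eq hn k l h h0 h1
  have hmuInv : fusing (.muInv k l h) = _ := isStringFamily_elemMuInv.generalized_eq hn k l h h0 h1
  rw [hmu, hmuInv, ← map_mul, ← map_mul, elemMu, elemMuInv, braid_v]
  constructor
  · rw [mul_assoc, vAt_mul_cancel, sigma_mul_sigmaInv, map_one]
  · rw [mul_assoc, ← mul_assoc (braid (.sigmaInv _)), sigmaInv_mul_sigma, one_mul, vAt_mul_self,
      map_one]

theorem fusing_twist (hn : 2 ≤ n) (k l : Fin n) (h : k ≠ l) :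
    fusing (.mu k l h) * fusing (.gamma l k h.symm) =
      fusing (.gamma k l h) * fusing (.mu l k h.symm) := by
  obtain ⟨s, rfl, rfl⟩ := exists_perm_pair hn h
  let a : Fin (n - 1) := ⟨0, by omega⟩
  have hgt (x : Fin (n - 1) → VSB n) :
      generalized x _ _ (lower_ne_upper a).symm = vAt n a * x a * vAt n a := generalized_gt rfl rfl
  have key : fusing (.mu _ _ (lower_ne_upper a)) * fusing (.gamma _ _ (lower_ne_upper a).symm) =
      fusing (.gamma _ _ (lower_ne_upper a)) * fusing (.mu _ _ (lower_ne_upper a).symm) := by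
    simp only [fusing, generalized_lower_upper, hgt, elemMu, elemGamma, braid_v]
    simp only [mul_assoc, vAt_mul_cancel, vAt_mul_self, mul_one]
    exact sigma_tau a
  have h2 := congrArg (conj n s) key
  simp only [map_mul, conj_fusing hn] at h2
  exact h2

theorem fusing_rel (hn : 2 ≤ n) (a b : FreeMonoid (PureGen n)) (h : PureRel n a b) :
    FreeMonoid.lift fusing a = FreeMonoid.lift fusing b := by
  have mu := isStringFamily_elemMu (n := n)
  have gamma := isStringFamily_elemGamma (n := n)
  cases h with
  | mu_inv k l h => simpa using (fusing_mul_inv hn k l h).1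
  | inv_mu k l h => simpa using (fusing_mul_inv hn k l h).2
  | yb i j k hij hik hjk =>
    simp only [map_mul, FreeMonoid.lift_eval_of]
    refine yangBaxter_generalized mu mu mu (fun a b hab => ?_) i j k hij hik hjk
    simp only [elemMu, braid_v]
    exact yangBaxter_elem (g := fun i => braid (.sigma i)) (h := fun i => braid (.sigma i))
      (k := fun i => braid (.sigma i)) hab (sigma_shift (.inl hab)) (sigma_shift (.inl hab))
      (sigma_sigma_sigma (.inl hab))
  | yb_mixed i j k hij hik hjk =>
    simp only [map_mul, FreeMonoid.lift_eval_of]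
    refine yangBaxter_generalized mu mu gamma (fun a b hab => ?_) i j k hij hik hjk
    simp only [elemMu, elemGamma, braid_v]
    exact yangBaxter_elem (g := fun i => braid (.sigma i)) (h := fun i => braid (.sigma i))
      (k := fun i => braid (.tau i)) hab (sigma_shift (.inl hab)) (tau_shift (.inl hab))
      (sigma_sigma_tau (.inl hab))
  | yb_mixed' i j k hij hik hjk =>
    simp only [map_mul, FreeMonoid.lift_eval_of]
    refine yangBaxter_generalized gamma mu mu (fun a b hab => ?_) i j k hij hik hjk
    simp only [elemMu, elemGamma, braid_v]
    exact yangBaxter_elem (g := fun i => braid (.tau i)) (h := fun i => braid (.sigma i))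
      (k := fun i => braid (.sigma i)) hab (tau_shift (.inl hab)) (sigma_shift (.inl hab))
      (sigma_sigma_tau (.inr hab)).symm
  | twist k l h => simpa using fusing_twist hn k l h
  | comm_mu_mu i j k l hij hkl hik hil hjk hjl =>
    simp only [map_mul, FreeMonoid.lift_eval_of]
    exact commute_generalized mu mu (fun a b => commute_elem (.inl rfl) (.inl rfl))
      i j k l hij hkl hik hil hjk hjl
  | comm_gamma_gamma i j k l hij hkl hik hil hjk hjl =>
    simp only [map_mul, FreeMonoid.lift_eval_of]
    exact commute_generalized gamma gamma
      (fun a b => commute_elem (.inr (.inl rfl)) (.inr (.inl rfl)))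
      i j k l hij hkl hik hil hjk hjl
  | comm_mu_gamma i j k l hij hkl hik hil hjk hjl =>
    simp only [map_mul, FreeMonoid.lift_eval_of]
    exact commute_generalized mu gamma (fun a b => commute_elem (.inl rfl) (.inr (.inl rfl)))
      i j k l hij hkl hik hil hjk hjl

/-- The homomorphism to `VSB n` from the monoid presented by the letters `μ_{kl}`, `μ_{kl}⁻¹`,
`γ_{kl}` and their relations. -/
def fusingHom (hn : 2 ≤ n) : PresentedMonoid (PureRel n) →* VSB n :=
  PresentedMonoid.lift fusing (fusing_rel hn)

/-! ### The fusing strings generate the kernel -/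

theorem perm_fusing (hn : 2 ≤ n) (g : PureGen n) : perm n (fusing g) = 1 := by
  have key {x : Fin (n - 1) → VSB n} (hx : IsStringFamily x) (h1 : ∀ i, perm n (x i) = 1)
      (k l : Fin n) (h : k ≠ l) : perm n (generalized x k l h) = 1 := by
    obtain ⟨s, hs0, hs1⟩ := exists_perm_pair hn h
    simp [hx.generalized_eq hn k l h hs0 hs1, conj_apply, h1]
  cases g with
  | mu k l h => exact key isStringFamily_elemMu (fun i => transposition_sq i) k l h
  | muInv k l h => exact key isStringFamily_elemMuInv (fun i => transposition_sq i) k l h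
  | gamma k l h => exact key isStringFamily_elemGamma (fun i => transposition_sq i) k l h

/-- Every virtual singular braid is a product of fusing strings followed by a virtual braid: the
virtual braids can be moved to the right past the fusing strings. -/
theorem exists_eq_mul_virtual (hn : 2 ≤ n) (x : VSB n) :
    ∃ p ∈ Submonoid.closure (Set.range (fusing (n := n))), ∃ w ∈ virtual n 0, x = p * w := by
  have hfusing {p w : VSB n} (hp : p ∈ Submonoid.closure (Set.range (fusing (n := n))))
      (hw : w ∈ virtual n 0) (g : PureGen n) :
      ∃ p' ∈ Submonoid.closure (Set.range (fusing (n := n))), p * w * fusing g = p' * w := by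
    refine ⟨p * fusing (g.map (perm n w)), mul_mem hp (Submonoid.subset_closure ⟨_, rfl⟩), ?_⟩
    rw [← conj_fusing hn, conj_apply, permLift_perm hw]
    have h := permLift_inv_mul_permLift (perm n w)
    rw [permLift_perm hw] at h
    simp only [mul_assoc, h, mul_one]
  have hv (i : Fin (n - 1)) : vAt n i ∈ virtual n 0 := vAt_mem_virtual (Nat.zero_le _)
  have hx : x ∈ Submonoid.closure (Set.range (PresentedMonoid.of (BraidRel n))) := by
    rw [PresentedMonoid.closure_range_of]
    trivial
  induction hx using Submonoid.closure_induction_right with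
  | one => exact ⟨1, one_mem _, 1, one_mem _, (one_mul 1).symm⟩
  | mul_right x _ y hy ih =>
    obtain ⟨p, hp, w, hw, rfl⟩ := ih
    obtain ⟨g, rfl⟩ := hy
    cases g with
    | sigma i =>
      obtain ⟨p', hp', h⟩ := hfusing hp hw (.mu _ _ (lower_ne_upper i))
      refine ⟨p', hp', w * vAt n i, mul_mem hw (hv i), ?_⟩
      rw [← mul_assoc, ← h, fusing, generalized_lower_upper, elemMu, braid_v]
      simp only [mul_assoc, vAt_mul_self, mul_one]
      rfl
    | sigmaInv i =>
      obtain ⟨p', hp', h⟩ := hfusing hp (mul_mem hw (hv i)) (.muInv _ _ (lower_ne_upper i))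
      refine ⟨p', hp', w * vAt n i, mul_mem hw (hv i), ?_⟩
      rw [← h, fusing, generalized_lower_upper, elemMuInv, braid_v]
      simp only [mul_assoc, vAt_mul_cancel]
      rfl
    | tau i =>
      obtain ⟨p', hp', h⟩ := hfusing hp hw (.gamma _ _ (lower_ne_upper i))
      refine ⟨p', hp', w * vAt n i, mul_mem hw (hv i), ?_⟩
      rw [← mul_assoc, ← h, fusing, generalized_lower_upper, elemGamma, braid_v]
      simp only [mul_assoc, vAt_mul_self, mul_one]
      rfl
    | v i =>
      refine ⟨p, hp, w * vAt n i, mul_mem hw (hv i), ?_⟩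
      rw [← mul_assoc, ← braid_v]
      rfl

theorem closure_fusing (hn : 2 ≤ n) :
    Submonoid.closure (Set.range (fusing (n := n))) = VSP n := by
  have hle : Submonoid.closure (Set.range (fusing (n := n))) ≤ VSP n := by
    rw [Submonoid.closure_le]
    rintro _ ⟨g, rfl⟩
    exact perm_fusing hn g
  refine le_antisymm hle fun x hx => ?_
  obtain ⟨p, hp, w, hw, rfl⟩ := exists_eq_mul_virtual hn x
  have h1 : perm n p = 1 := hle hp
  have h2 : perm n (p * w) = 1 := hx
  rw [map_mul, h1, one_mul] at h2
  rwa [eq_one_of_perm_eq_one hw h2, mul_one]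

/-! ### The semidirect product of the presented monoid and the symmetric group -/

/-- The semidirect product of a monoid `M` and a group `G` acting on `M` by endomorphisms, with
the multiplication `(a, s) (b, t) = (a (s • b), s t)`; the group `G` is written on the right. -/
@[ext]
structure Semidirect {M G : Type*} [Monoid M] [Group G] (φ : G →* Monoid.End M) where
  /-- The component in `M`. -/
  left : M
  /-- The component in `G`. -/
  right : G

namespace Semidirect

variable {M G : Type*} [Monoid M] [Group G] {φ : G →* Monoid.End M}

instance : Mul (Semidirect φ) := ⟨fun a b => ⟨a.left * φ a.right b.left, a.right * b.right⟩⟩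

instance : One (Semidirect φ) := ⟨⟨1, 1⟩⟩

theorem mk_mul_mk (a b : M) (s t : G) :
    (⟨a, s⟩ * ⟨b, t⟩ : Semidirect φ) = ⟨a * φ s b, s * t⟩ := rfl

theorem one_def : (1 : Semidirect φ) = ⟨1, 1⟩ := rfl

instance : Monoid (Semidirect φ) where
  mul_assoc := by
    rintro ⟨a, s⟩ ⟨b, t⟩ ⟨c, u⟩
    simp [mk_mul_mk, mul_assoc]
  one_mul := by
    rintro ⟨a, s⟩
    simp [mk_mul_mk, one_def]
  mul_one := by
    rintro ⟨a, s⟩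
    simp [mk_mul_mk, one_def]

/-- The inclusion of `M` in the semidirect product. -/
def inl : M →* Semidirect φ where
  toFun a := ⟨a, 1⟩
  map_one' := rfl
  map_mul' a b := by simp [mk_mul_mk]

end Semidirect

theorem map_rel (s : Equiv.Perm (Fin n)) (a b : FreeMonoid (PureGen n)) (h : PureRel n a b) :
    FreeMonoid.lift (fun g : PureGen n => PresentedMonoid.of (PureRel n) (g.map s)) a =
      FreeMonoid.lift (fun g : PureGen n => PresentedMonoid.of (PureRel n) (g.map s)) b := by
  have hs {k l : Fin n} (h : k ≠ l) : s k ≠ s l := s.injective.ne h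
  cases h with
  | mu_inv k l h => exact PresentedMonoid.mk_eq_mk_of_rel (.mu_inv _ _ (hs h))
  | inv_mu k l h => exact PresentedMonoid.mk_eq_mk_of_rel (.inv_mu _ _ (hs h))
  | yb i j k hij hik hjk =>
    exact PresentedMonoid.mk_eq_mk_of_rel (.yb _ _ _ (hs hij) (hs hik) (hs hjk))
  | yb_mixed i j k hij hik hjk =>
    exact PresentedMonoid.mk_eq_mk_of_rel (.yb_mixed _ _ _ (hs hij) (hs hik) (hs hjk))
  | yb_mixed' i j k hij hik hjk =>
    exact PresentedMonoid.mk_eq_mk_of_rel (.yb_mixed' _ _ _ (hs hij) (hs hik) (hs hjk))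
  | twist k l h => exact PresentedMonoid.mk_eq_mk_of_rel (.twist _ _ (hs h))
  | comm_mu_mu i j k l hij hkl hik hil hjk hjl =>
    exact PresentedMonoid.mk_eq_mk_of_rel
      (.comm_mu_mu _ _ _ _ (hs hij) (hs hkl) (hs hik) (hs hil) (hs hjk) (hs hjl))
  | comm_gamma_gamma i j k l hij hkl hik hil hjk hjl =>
    exact PresentedMonoid.mk_eq_mk_of_rel
      (.comm_gamma_gamma _ _ _ _ (hs hij) (hs hkl) (hs hik) (hs hil) (hs hjk) (hs hjl))
  | comm_mu_gamma i j k l hij hkl hik hil hjk hjl =>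
    exact PresentedMonoid.mk_eq_mk_of_rel
      (.comm_mu_gamma _ _ _ _ (hs hij) (hs hkl) (hs hik) (hs hil) (hs hjk) (hs hjl))

theorem PureGen.map_one (g : PureGen n) : g.map 1 = g := by cases g <;> rfl

theorem PureGen.map_mul (s t : Equiv.Perm (Fin n)) (g : PureGen n) :
    g.map (s * t) = (g.map t).map s := by cases g <;> rfl

/-- The action of `S_n` on the presented monoid by permutation of the indices. -/
def permute (n : ℕ) : Equiv.Perm (Fin n) →* Monoid.End (PresentedMonoid (PureRel n)) where
  toFun s := PresentedMonoid.lift _ (map_rel s)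
  map_one' := PresentedMonoid.ext _ fun g =>
    congrArg (PresentedMonoid.of (PureRel n)) g.map_one
  map_mul' s t := PresentedMonoid.ext _ fun g =>
    congrArg (PresentedMonoid.of (PureRel n)) (g.map_mul s t)

theorem permute_of (s : Equiv.Perm (Fin n)) (g : PureGen n) :
    permute n s (PresentedMonoid.of (PureRel n) g) = PresentedMonoid.of (PureRel n) (g.map s) :=
  rfl

theorem transposition_eq (i : Fin (n - 1)) : transposition i = Equiv.swap (lower i) (upper i) :=
  rfl

/-- The factorization of an elementary braid into a fusing string and a transposition:
`σ_i = μ_i v_i`, `τ_i = γ_i v_i`, and `σ_i⁻¹ = v_i μ_i⁻¹ = (v_i μ_i⁻¹ v_i) v_i`. -/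
def splitGen : BraidGen n → Semidirect (permute n)
  | .sigma i => ⟨PresentedMonoid.of _ (.mu _ _ (lower_ne_upper i)), transposition i⟩
  | .sigmaInv i => ⟨PresentedMonoid.of _ (.muInv _ _ (lower_ne_upper i).symm), transposition i⟩
  | .tau i => ⟨PresentedMonoid.of _ (.gamma _ _ (lower_ne_upper i)), transposition i⟩
  | .v i => ⟨1, transposition i⟩

theorem transposition_lower (i : Fin (n - 1)) : transposition i (lower i) = upper i :=
  Equiv.swap_apply_left _ _

theorem transposition_upper (i : Fin (n - 1)) : transposition i (upper i) = lower i :=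
  Equiv.swap_apply_right _ _

section

variable {i j : Fin (n - 1)}

theorem upper_eq_lower (h : i.val + 1 = j.val) : upper i = lower j := Fin.ext h

theorem lower_ne_lower_of_succ (h : i.val + 1 = j.val) : lower i ≠ lower j := by
  simp [lower]; omega

theorem lower_ne_upper_of_succ (h : i.val + 1 = j.val) : lower i ≠ upper j := by
  simp [lower, upper]; omega

/-- The values at `i`, `i + 1`, `i + 2` of two neighbouring transpositions. -/
theorem transposition_adjacent (h : i.val + 1 = j.val) :
    transposition i (lower j) = lower i ∧ transposition i (upper j) = upper j ∧
      transposition j (lower i) = lower i := by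
  have h1 := lower_ne_upper j
  have h2 := lower_ne_lower_of_succ h
  have h3 := lower_ne_upper_of_succ h
  rw [transposition_eq, transposition_eq, upper_eq_lower h]
  exact ⟨Equiv.swap_apply_right _ _, Equiv.swap_apply_of_ne_of_ne h3.symm h1.symm,
    Equiv.swap_apply_of_ne_of_ne h2 h3⟩

theorem transposition_far (h : Far i j) :
    transposition i (lower j) = lower j ∧ transposition i (upper j) = upper j := by
  have h' : i.val + 1 < j.val ∨ j.val + 1 < i.val := h
  constructor <;> apply Equiv.swap_apply_of_ne_of_ne <;> simp [lower, upper, Fin.ext_iff] <;> omega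

theorem Far.symm (h : Far i j) : Far j i := Or.symm h

theorem Far.lower_ne_lower (h : Far i j) : lower i ≠ lower j := by
  have h' : i.val + 1 < j.val ∨ j.val + 1 < i.val := h
  simp [lower]; omega

theorem Far.lower_ne_upper (h : Far i j) : lower i ≠ upper j := by
  have h' : i.val + 1 < j.val ∨ j.val + 1 < i.val := h
  simp [lower, upper]; omega

theorem Far.upper_ne_upper (h : Far i j) : upper i ≠ upper j := by
  have h' : i.val + 1 < j.val ∨ j.val + 1 < i.val := h
  simp [upper]; omega

end

open PresentedMonoid (mk_eq_mk_of_rel)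

theorem splitGen_r3 {i j : Fin (n - 1)} (h : i.val + 1 = j.val) :
    (splitGen (.sigma i) * splitGen (.sigma j) * splitGen (.sigma i) : Semidirect (permute n)) =
      splitGen (.sigma j) * splitGen (.sigma i) * splitGen (.sigma j) := by
  obtain ⟨h1, h2, h3⟩ := transposition_adjacent h
  simp only [splitGen, Semidirect.mk_mul_mk, permute_of, PureGen.map, Equiv.Perm.mul_apply,
    upper_eq_lower h, h1, h2, h3, transposition_lower, transposition_upper,
    transposition_braid (.inl h)]
  congr 1
  exact mk_eq_mk_of_rel
    (.yb _ _ _ (lower_ne_lower_of_succ h) (lower_ne_upper_of_succ h) (lower_ne_upper j))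

theorem splitGen_vr3 {i j : Fin (n - 1)} (h : i.val + 1 = j.val) :
    (splitGen (.v i) * splitGen (.sigma j) * splitGen (.v i) : Semidirect (permute n)) =
      splitGen (.v j) * splitGen (.sigma i) * splitGen (.v j) := by
  obtain ⟨h1, h2, h3⟩ := transposition_adjacent h
  simp only [splitGen, Semidirect.mk_mul_mk, permute_of, PureGen.map, map_one, one_mul, mul_one,
    upper_eq_lower h, h1, h2, h3, transposition_lower, transposition_braid (.inl h)]

theorem splitGen_vs3 {i j : Fin (n - 1)} (h : i.val + 1 = j.val) :
    (splitGen (.v i) * splitGen (.tau j) * splitGen (.v i) : Semidirect (permute n)) =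
      splitGen (.v j) * splitGen (.tau i) * splitGen (.v j) := by
  obtain ⟨h1, h2, h3⟩ := transposition_adjacent h
  simp only [splitGen, Semidirect.mk_mul_mk, permute_of, PureGen.map, map_one, one_mul, mul_one,
    upper_eq_lower h, h1, h2, h3, transposition_lower, transposition_braid (.inl h)]

theorem splitGen_rs3 {i j : Fin (n - 1)} (h : i.val + 1 = j.val) :
    (splitGen (.sigma i) * splitGen (.sigma j) * splitGen (.tau i) : Semidirect (permute n)) =
      splitGen (.tau j) * splitGen (.sigma i) * splitGen (.sigma j) := by
  obtain ⟨h1, h2, h3⟩ := transposition_adjacent h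
  simp only [splitGen, Semidirect.mk_mul_mk, permute_of, PureGen.map, Equiv.Perm.mul_apply,
    upper_eq_lower h, h1, h2, h3, transposition_lower, transposition_upper,
    transposition_braid (.inl h)]
  congr 1
  exact mk_eq_mk_of_rel
    (.yb_mixed _ _ _ (lower_ne_lower_of_succ h) (lower_ne_upper_of_succ h) (lower_ne_upper j))

theorem splitGen_rs3' {i j : Fin (n - 1)} (h : i.val + 1 = j.val) :
    (splitGen (.sigma j) * splitGen (.sigma i) * splitGen (.tau j) : Semidirect (permute n)) =
      splitGen (.tau i) * splitGen (.sigma j) * splitGen (.sigma i) := by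
  obtain ⟨h1, h2, h3⟩ := transposition_adjacent h
  simp only [splitGen, Semidirect.mk_mul_mk, permute_of, PureGen.map, Equiv.Perm.mul_apply,
    upper_eq_lower h, h1, h2, h3, transposition_lower, transposition_upper,
    transposition_braid (.inl h)]
  congr 1
  exact (mk_eq_mk_of_rel
    (.yb_mixed' _ _ _ (lower_ne_lower_of_succ h) (lower_ne_upper_of_succ h)
      (lower_ne_upper j))).symm

theorem splitGen_rs1 (i : Fin (n - 1)) :
    (splitGen (.sigma i) * splitGen (.tau i) : Semidirect (permute n)) =
      splitGen (.tau i) * splitGen (.sigma i) := by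
  simp only [splitGen, Semidirect.mk_mul_mk, permute_of, PureGen.map, transposition_lower,
    transposition_upper]
  congr 1
  exact mk_eq_mk_of_rel (.twist _ _ (lower_ne_upper i))

theorem splitGen_comm {g h : Fin (n - 1) → BraidGen n} (hg : g = .sigma ∨ g = .tau ∨ g = .v)
    (hh : h = .sigma ∨ h = .tau ∨ h = .v) {i j : Fin (n - 1)} (hij : Far i j) :
    (splitGen (g i) * splitGen (h j) : Semidirect (permute n)) =
      splitGen (h j) * splitGen (g i) := by
  obtain ⟨h1, h2⟩ := transposition_far hij
  obtain ⟨h3, h4⟩ := transposition_far hij.symm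
  have h5 := hij.lower_ne_lower
  have h6 := hij.lower_ne_upper
  have h7 := hij.symm.lower_ne_upper.symm
  have h8 := hij.upper_ne_upper
  have hi := lower_ne_upper i
  have hj := lower_ne_upper j
  rcases hg with rfl | rfl | rfl <;> rcases hh with rfl | rfl | rfl <;>
    simp only [splitGen, Semidirect.mk_mul_mk, permute_of, PureGen.map, h1, h2, h3, h4,
      transposition_comm hij, map_one, one_mul, mul_one] <;>
    congr 1
  · exact mk_eq_mk_of_rel (.comm_mu_mu _ _ _ _ hi hj h5 h6 h7 h8)
  · exact mk_eq_mk_of_rel (.comm_mu_gamma _ _ _ _ hi hj h5 h6 h7 h8)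
  · exact (mk_eq_mk_of_rel (.comm_mu_gamma _ _ _ _ hj hi h5.symm h7.symm h6.symm h8.symm)).symm
  · exact mk_eq_mk_of_rel (.comm_gamma_gamma _ _ _ _ hi hj h5 h6 h7 h8)

theorem splitGen_rel (a b : FreeMonoid (BraidGen n)) (h : BraidRel n a b) :
    FreeMonoid.lift splitGen a = FreeMonoid.lift splitGen b := by
  cases h with
  | sigma_inv i =>
    simp only [map_mul, map_one, FreeMonoid.lift_eval_of, splitGen, Semidirect.mk_mul_mk,
      permute_of, PureGen.map, transposition_lower, transposition_upper, transposition_sq]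
    exact Semidirect.ext (mk_eq_mk_of_rel (.mu_inv _ _ (lower_ne_upper i))) rfl
  | inv_sigma i =>
    simp only [map_mul, map_one, FreeMonoid.lift_eval_of, splitGen, Semidirect.mk_mul_mk,
      permute_of, PureGen.map, transposition_lower, transposition_upper, transposition_sq]
    exact Semidirect.ext (mk_eq_mk_of_rel (.inv_mu _ _ (lower_ne_upper i).symm)) rfl
  | v_sq i =>
    simp only [map_mul, map_one, FreeMonoid.lift_eval_of, splitGen, Semidirect.mk_mul_mk,
      transposition_sq, mul_one]
    rfl
  | r3 i j h =>
    simp only [map_mul, FreeMonoid.lift_eval_of]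
    exact h.elim (fun h => splitGen_r3 h) fun h => (splitGen_r3 h).symm
  | v3 i j h =>
    simp only [map_mul, map_one, FreeMonoid.lift_eval_of, splitGen, Semidirect.mk_mul_mk, mul_one,
      transposition_braid h]
  | vr3 i j h =>
    simp only [map_mul, FreeMonoid.lift_eval_of]
    exact h.elim (fun h => splitGen_vr3 h) fun h => (splitGen_vr3 h).symm
  | vs3 i j h =>
    simp only [map_mul, FreeMonoid.lift_eval_of]
    exact h.elim (fun h => splitGen_vs3 h) fun h => (splitGen_vs3 h).symm
  | rs3 i j h =>
    simp only [map_mul, FreeMonoid.lift_eval_of]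
    exact h.elim (fun h => splitGen_rs3 h) fun h => splitGen_rs3' h
  | rs1 i =>
    simp only [map_mul, FreeMonoid.lift_eval_of]
    exact splitGen_rs1 i
  | comm g h hg hh i j hij =>
    simp only [map_mul, FreeMonoid.lift_eval_of]
    exact splitGen_comm hg hh hij

/-- The homomorphism from `VSB n` to the semidirect product of the presented monoid and `S_n`. -/
def split (n : ℕ) : VSB n →* Semidirect (permute n) := PresentedMonoid.lift splitGen splitGen_rel

theorem split_braid (g : BraidGen n) : split n (braid g) = splitGen g := rfl

theorem split_of_mem_virtual {w : VSB n} (hw : w ∈ virtual n 0) :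
    split n w = ⟨1, perm n w⟩ := by
  induction hw using Submonoid.closure_induction with
  | mem x hx =>
    obtain ⟨j, -, rfl⟩ := hx
    by_cases hj : j < n - 1
    · rw [vAt_of_lt hj]
      rfl
    · rw [vAt_of_not_lt hj, map_one, map_one]
      rfl
  | one =>
    rw [map_one, map_one]
    rfl
  | mul x y _ _ hx hy => simp only [map_mul, hx, hy, Semidirect.mk_mul_mk, map_one, mul_one]

theorem split_conj (s : Equiv.Perm (Fin n)) {x : VSB n} {m : PresentedMonoid (PureRel n)}
    (hx : split n x = ⟨m, 1⟩) : split n (conj n s x) = ⟨permute n s m, 1⟩ := by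
  simp only [conj_apply, map_mul, hx, split_of_mem_virtual (permLift_mem _), perm_permLift,
    Semidirect.mk_mul_mk, map_one, mul_one, one_mul, mul_inv_cancel]

/-- The homomorphism `split` sends each fusing string to its letter. -/
theorem split_fusing (hn : 2 ≤ n) (g : PureGen n) :
    split n (fusing g) = ⟨PresentedMonoid.of (PureRel n) g, 1⟩ := by
  let a : Fin (n - 1) := ⟨0, by omega⟩
  cases g with
  | mu k l h =>
    obtain ⟨s, rfl, rfl⟩ := exists_perm_pair hn h
    have key : split n (elemMu a) = ⟨.of _ (.mu _ _ (lower_ne_upper a)), 1⟩ := by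
      simp only [elemMu, map_mul, split_braid, splitGen, Semidirect.mk_mul_mk, map_one, mul_one,
        transposition_sq]
    rw [fusing, isStringFamily_elemMu.generalized_eq hn _ _ h rfl rfl]
    exact split_conj s key
  | muInv k l h =>
    obtain ⟨s, rfl, rfl⟩ := exists_perm_pair hn h
    have key : split n (elemMuInv a) = ⟨.of _ (.muInv _ _ (lower_ne_upper a)), 1⟩ := by
      simp only [elemMuInv, map_mul, split_braid, splitGen, Semidirect.mk_mul_mk, one_mul,
        permute_of, PureGen.map, transposition_lower, transposition_upper, transposition_sq]
    rw [fusing, isStringFamily_elemMuInv.generalized_eq hn _ _ h rfl rfl]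
    exact split_conj s key
  | gamma k l h =>
    obtain ⟨s, rfl, rfl⟩ := exists_perm_pair hn h
    have key : split n (elemGamma a) = ⟨.of _ (.gamma _ _ (lower_ne_upper a)), 1⟩ := by
      simp only [elemGamma, map_mul, split_braid, splitGen, Semidirect.mk_mul_mk, map_one, mul_one,
        transposition_sq]
    rw [fusing, isStringFamily_elemGamma.generalized_eq hn _ _ h rfl rfl]
    exact split_conj s key

theorem fusingHom_injective (hn : 2 ≤ n) : Function.Injective (fusingHom hn) := by
  have key : (split n).comp (fusingHom hn) = Semidirect.inl :=
    PresentedMonoid.ext _ fun g => split_fusing hn g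
  intro x y h
  exact congrArg Semidirect.left <|
    (DFunLike.congr_fun key x).symm.trans ((congrArg (split n) h).trans (DFunLike.congr_fun key y))

theorem mrange_fusingHom (hn : 2 ≤ n) : MonoidHom.mrange (fusingHom hn) = VSP n := by
  rw [← closure_fusing hn, MonoidHom.mrange_eq_map, ← PresentedMonoid.closure_range_of,
    MonoidHom.map_mclosure, ← Set.range_comp]
  rfl

end VSBraid

theorem theorem4p3 (n : ℕ) (hn : 2 ≤ n) :
    Submonoid.closure (Set.range (VSBraid.fusing (n := n))) = VSBraid.VSP n ∧
    ∃ e : PresentedMonoid (VSBraid.PureRel n) ≃* VSBraid.VSP n,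
      ∀ g : VSBraid.PureGen n,
        (e (PresentedMonoid.of (VSBraid.PureRel n) g) : VSBraid.VSB n) = VSBraid.fusing g := by
  refine ⟨VSBraid.closure_fusing hn, MulEquiv.ofBijective
    ((VSBraid.fusingHom hn).codRestrict (VSBraid.VSP n) fun x => ?_) ⟨?_, ?_⟩, fun g => rfl⟩
  · rw [← VSBraid.mrange_fusingHom hn]
    exact ⟨x, rfl⟩
  · exact fun x y h => VSBraid.fusingHom_injective hn (congrArg Subtype.val h)
  · rintro ⟨y, hy⟩
    rw [← VSBraid.mrange_fusingHom hn] at hy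
    obtain ⟨x, rfl⟩ := hy
    exact ⟨x, rfl⟩
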